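/- Let $n,m,p,\bar n\in\mathbb N$ and let $A\in\mathbb R^{n\times n}$, $B\in\mathbb R^{n\times m}$, $C\in\mathbb R^{p\times n}$, $\bar A\in\mathbb R^{\bar n\times\bar n}$, $\bar C\in\mathbb R^{p\times\bar n}$, and let $Q\in\mathbb R^{p\times p}$, $R\in\mathbb R^{m\times m}$ be symmetric positive definite. Assume: (i) $(A,B)$ is stabilizable and $(A,C)$ is detectable, i.e. there are real matrices $K$, $L$ such that all eigenvalues of $A-BK$ and of $A-LC$ have negative real part; (ii) all eigenvalues of $\bar A$ are semi-simple and have real part $0$; (iii) with the frequency spectrum $\bar\Omega=\{\operatorname{Im}\lambda\ge 0 \mid \lambda \text{ an eigenvalue of } \bar A\}$ (a multiset, with multiplicities), $\omega/\omega'\in\mathbb Q$ for all nonzero $\omega,\omega'\in\bar\Omega$; (iv) $\bar A$ is in harmonic normal form: up to the order of the coordinates, $\bar A=\operatorname{diag}(\bar A_0,\bar A_1,\dots,\bar A_N)$, where $\bar A_0=0$ has size $m_{\bar\Omega}(0)$ and $\bar A_j=\omega_j\left(I_{m_{\bar\Omega}(\omega_j)}\otimes\begin{pmatrix}0&1\\-1&0\end{pmatrix}\right)$,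 $j=1,\dots,N$, with $\omega_1,\dots,\omega_N>0$ the distinct nonzero elements of $\bar\Omega$ and $m_{\bar\Omega}(\omega)$ the multiplicity of $\omega$ in $\bar\Omega$ (the zero block or the harmonic blocks may be absent). Then the equation $$\begin{pmatrix}\Pi\\ \Pi_\lambda\end{pmatrix}\bar A=\begin{pmatrix}A&-BR^{-1}B^{\top}\\-C^{\top}QC&-A^{\top}\end{pmatrix}\begin{pmatrix}\Pi\\ \Pi_\lambda\end{pmatrix}+\begin{pmatrix}0\\ C^{\top}Q\bar C\end{pmatrix}$$ has exactly one solution $\Pi=\Pi^*$, $\Pi_\lambda=\Pi_\lambda^*$ in $\mathbb R^{n\times\bar n}\times\mathbb R^{n\times\bar n}$, and, with $\Gamma^*=-R^{-1}B^{\top}\Pi_\lambda^*$, the pair $(\Pi^*,\Gamma^*)$ is the unique minimizer of $$\operatorname{trace}\left((C\Pi-\bar C)^{\top}Q(C\Pi-\bar C)+\Gamma^{\top}R\,\Gamma\right)$$ over all $(\Pi,\Gamma)\in\mathbb R^{n\times\bar n}\times\mathbb R^{m\times\bar n}$ subject to $\Pi\bar A=A\Pi+B\Gamma$. -/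

import Mathlib

open scoped Matrix Kronecker

/-- A real square matrix, regarded as a complex one. -/
noncomputable def complexify {ι : Type*} (M : Matrix ι ι ℝ) : Matrix ι ι ℂ :=
  M.map (algebraMap ℝ ℂ)

/-- All (complex) eigenvalues have negative real part. -/
def IsHurwitz {ι : Type*} [Fintype ι] [DecidableEq ι] (M : Matrix ι ι ℝ) : Prop :=
  ∀ z ∈ spectrum ℂ (complexify M), z.re < 0

/-- `(A, B)` is stabilizable: some state feedback makes `A - B K` Hurwitz. -/
def IsStabilizable {n m : ℕ} (A : Matrix (Fin n) (Fin n) ℝ) (B : Matrix (Fin n) (Fin m) ℝ) :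
    Prop :=
  ∃ K : Matrix (Fin m) (Fin n) ℝ, IsHurwitz (A - B * K)

/-- `(A, C)` is detectable: some output injection makes `A - L C` Hurwitz. -/
def IsDetectable {n p : ℕ} (A : Matrix (Fin n) (Fin n) ℝ) (C : Matrix (Fin p) (Fin n) ℝ) :
    Prop :=
  ∃ L : Matrix (Fin n) (Fin p) ℝ, IsHurwitz (A - L * C)

/-- All complex eigenvalues are semi-simple (every generalized eigenspace is the eigenspace)
and lie on the imaginary axis. -/
def HasSemisimpleImaginarySpectrum {q : ℕ} (S : Matrix (Fin q) (Fin q) ℝ) : Prop :=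
  ∀ z ∈ spectrum ℂ (complexify S),
    z.re = 0 ∧
      Module.End.maxGenEigenspace (Matrix.toLin' (complexify S)) z =
        Module.End.eigenspace (Matrix.toLin' (complexify S)) z

open Classical in
/-- The frequency spectrum: the multiset of the imaginary parts `Im z ≥ 0` of the complex
eigenvalues `z`, counted with algebraic multiplicity. -/
noncomputable def frequencySpectrum {q : ℕ} (S : Matrix (Fin q) (Fin q) ℝ) : Multiset ℝ :=
  ((complexify S).charpoly.roots.filter (fun z : ℂ => 0 ≤ z.im)).map Complex.im

/-- All ratios of nonzero frequencies are rational. -/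
def HasRationalFrequencyRatios {q : ℕ} (S : Matrix (Fin q) (Fin q) ℝ) : Prop :=
  ∀ w₁ ∈ frequencySpectrum S, ∀ w₂ ∈ frequencySpectrum S, w₁ ≠ 0 → w₂ ≠ 0 →
    ∃ r : ℚ, w₁ / w₂ = (r : ℝ)

/-- The block-diagonal matrix `diag(0, ω₀ (I ⊗ J), …, ω_{N-1} (I ⊗ J))` with
`J = [0 1; -1 0]`, a zero block of size `k₀`, and identity matrices of sizes `k j`. -/
def harmonicBlocks (k₀ N : ℕ) (k : Fin N → ℕ) (w : Fin N → ℝ) :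
    Matrix (Fin k₀ ⊕ (Σ j : Fin N, Fin (k j) × Fin 2))
      (Fin k₀ ⊕ (Σ j : Fin N, Fin (k j) × Fin 2)) ℝ :=
  Matrix.fromBlocks 0 0 0
    (Matrix.blockDiagonal' fun j =>
      w j • ((1 : Matrix (Fin (k j)) (Fin (k j)) ℝ) ⊗ₖ !![(0 : ℝ), 1; -1, 0]))

/-- Harmonic normal form: up to the enumeration `e` of the coordinates, the matrix is
`harmonicBlocks` with pairwise distinct positive frequencies, each of which occurs
(so the `w j` are the distinct nonzero elements of the frequency spectrum, and `k₀`, `k j`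
are the multiplicities of `0` and of `w j` in it). -/
def IsHarmonicNormalForm {q : ℕ} (S : Matrix (Fin q) (Fin q) ℝ) : Prop :=
  ∃ (k₀ N : ℕ) (k : Fin N → ℕ) (w : Fin N → ℝ)
    (e : (Fin k₀ ⊕ (Σ j : Fin N, Fin (k j) × Fin 2)) ≃ Fin q),
    (∀ j, 0 < k j) ∧ (∀ j, 0 < w j) ∧ Function.Injective w ∧
      S = Matrix.reindex e e (harmonicBlocks k₀ N k w)

/-- The Hamiltonian Sylvester equation
`[P; Λ] S = [A, -B R⁻¹ Bᵀ; -Cᵀ Q C, -Aᵀ] [P; Λ] + [0; Cᵀ Q D]`. -/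
def SolvesHamiltonianSylvester {n m p q : ℕ}
    (A : Matrix (Fin n) (Fin n) ℝ) (B : Matrix (Fin n) (Fin m) ℝ)
    (C : Matrix (Fin p) (Fin n) ℝ)
    (Q : Matrix (Fin p) (Fin p) ℝ) (R : Matrix (Fin m) (Fin m) ℝ)
    (S : Matrix (Fin q) (Fin q) ℝ) (D : Matrix (Fin p) (Fin q) ℝ)
    (P Λ : Matrix (Fin n) (Fin q) ℝ) : Prop :=
  Matrix.fromRows P Λ * S =
    Matrix.fromBlocks A (-(B * R⁻¹ * Bᵀ)) (-(Cᵀ * Q * C)) (-Aᵀ) * Matrix.fromRows P Λ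
      + Matrix.fromRows 0 (Cᵀ * Q * D)

/-- The objective `trace((C P - D)ᵀ Q (C P - D) + Gᵀ R G)`. -/
def traceCost {n m p q : ℕ} (C : Matrix (Fin p) (Fin n) ℝ)
    (Q : Matrix (Fin p) (Fin p) ℝ) (R : Matrix (Fin m) (Fin m) ℝ)
    (D : Matrix (Fin p) (Fin q) ℝ)
    (X : Matrix (Fin n) (Fin q) ℝ × Matrix (Fin m) (Fin q) ℝ) : ℝ :=
  ((C * X.1 - D)ᵀ * Q * (C * X.1 - D) + X.2ᵀ * R * X.2).trace

/-- The pairs `(P, G)` with `P S = A P + B G`. -/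
def regulatorFeasible {n m q : ℕ}
    (A : Matrix (Fin n) (Fin n) ℝ) (B : Matrix (Fin n) (Fin m) ℝ)
    (S : Matrix (Fin q) (Fin q) ℝ) :
    Set (Matrix (Fin n) (Fin q) ℝ × Matrix (Fin m) (Fin q) ℝ) :=
  {X | X.1 * S = A * X.1 + B * X.2}

/-- The set of (global) minimizers of the trace objective over the feasible pairs. -/
def traceArgmin {n m p q : ℕ}
    (A : Matrix (Fin n) (Fin n) ℝ) (B : Matrix (Fin n) (Fin m) ℝ)
    (C : Matrix (Fin p) (Fin n) ℝ)
    (Q : Matrix (Fin p) (Fin p) ℝ) (R : Matrix (Fin m) (Fin m) ℝ)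
    (S : Matrix (Fin q) (Fin q) ℝ) (D : Matrix (Fin p) (Fin q) ℝ) :
    Set (Matrix (Fin n) (Fin q) ℝ × Matrix (Fin m) (Fin q) ℝ) :=
  {X | X ∈ regulatorFeasible A B S ∧
    ∀ Y ∈ regulatorFeasible A B S, traceCost C Q R D X ≤ traceCost C Q R D Y}

/-! The harmonic normal form makes `Abar` skew-symmetric. Pairing the two homogeneous block
equations under the trace then gives `‖Bᵀ Λ‖² + ‖C P‖² = 0` in the norms weighted by `R⁻¹` and `Q`.
So `P` intertwines `Abar` with `A - L C`, whose spectrum is disjoint from the imaginary axis, and `P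
= 0`; dually `Λ = 0`. The Hamiltonian Sylvester operator is thus injective, hence bijective by
finite dimension (`hamiltonianSylvesterMap_injective`).

For optimality, `Λ` is the Lagrange multiplier of the linear constraint: the first variation at the
solution vanishes, so the cost is its value there plus a nonnegative quadratic form
(`traceCost_eq_add_of_solves`). By detectability this form is definite on feasible directions. -/

open Matrix in
theorem trace_transpose_mul_mul_nonneg {ι κ : Type*} [Fintype ι] [Fintype κ]
    {Q : Matrix ι ι ℝ} (hQ : Q.PosDef) (X : Matrix ι κ ℝ) : 0 ≤ (Xᵀ * Q * X).trace := by
  have h := (hQ.posSemidef.conjTranspose_mul_mul_same X).trace_nonneg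
  rwa [conjTranspose_eq_transpose_of_trivial] at h

open Matrix in
theorem eq_zero_of_trace_transpose_mul_mul_eq_zero {ι κ : Type*} [Fintype ι] [Fintype κ]
    {Q : Matrix ι ι ℝ} (hQ : Q.PosDef) {X : Matrix ι κ ℝ} (h : (Xᵀ * Q * X).trace = 0) :
    X = 0 := by
  have hps := hQ.posSemidef.conjTranspose_mul_mul_same X
  rw [conjTranspose_eq_transpose_of_trivial] at hps
  have h0 : Xᵀ * Q * X = 0 := hps.trace_eq_zero_iff.mp h
  ext i j
  by_contra hij
  have hne : X.col j ≠ 0 := fun hc => hij (congrFun hc i)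
  have hpos := hQ.dotProduct_mulVec_pos hne
  have hjj : (Xᵀ * Q * X) j j = X.col j ⬝ᵥ (Q *ᵥ X.col j) := by
    rw [Matrix.mul_assoc]
    rfl
  rw [h0] at hjj
  rw [star_trivial, ← hjj] at hpos
  exact lt_irrefl _ hpos

/-! ### Sylvester equations with disjoint spectra -/

/-- Intertwining `X S = M X` passes to polynomials in `S` and `M`. -/
theorem mul_aeval_of_intertwines {ι κ 𝕜 : Type*} [Fintype ι] [DecidableEq ι] [Fintype κ]
    [DecidableEq κ] [CommRing 𝕜] {M : Matrix ι ι 𝕜} {S : Matrix κ κ 𝕜} {X : Matrix ι κ 𝕜}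
    (h : X * S = M * X) (f : Polynomial 𝕜) :
    X * Polynomial.aeval S f = Polynomial.aeval M f * X := by
  induction f using Polynomial.induction_on' with
  | add f g hf hg => rw [map_add, map_add, Matrix.mul_add, Matrix.add_mul, hf, hg]
  | monomial k a =>
    have hk : X * S ^ k = M ^ k * X := by
      induction k with
      | zero => simp
      | succ k ih => rw [pow_succ, ← Matrix.mul_assoc, ih, Matrix.mul_assoc, h,
          ← Matrix.mul_assoc, ← pow_succ]
    simp only [Polynomial.aeval_monomial, ← Algebra.smul_def]
    rw [Matrix.mul_smul, Matrix.smul_mul, hk]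

/-- The homogeneous Sylvester equation over `ℂ` has only the zero solution if the spectra are
disjoint. -/
theorem eq_zero_of_intertwines_of_disjoint_spectrum {ι κ : Type*} [Fintype ι] [DecidableEq ι]
    [Fintype κ] [DecidableEq κ] {M : Matrix ι ι ℂ} {S : Matrix κ κ ℂ} {X : Matrix ι κ ℂ}
    (hMS : Disjoint (spectrum ℂ M) (spectrum ℂ S)) (h : X * S = M * X) : X = 0 := by
  cases isEmpty_or_nonempty ι with
  | inl hι => ext i; exact isEmptyElim i
  | inr hι =>
    have hdeg : 0 < M.charpoly.degree := by
      rw [Matrix.charpoly_degree_eq_dim]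
      exact_mod_cast Fintype.card_pos
    -- By spectral mapping the eigenvalues of `χ_M(S)` are `χ_M(z)` with `z` in the spectrum of `S`,
    -- none of them zero. Cayley–Hamilton then turns the intertwining into `X * χ_M(S) = 0`.
    have hunit : IsUnit (Polynomial.aeval S M.charpoly) := by
      rw [← spectrum.zero_notMem_iff ℂ, spectrum.map_polynomial_aeval_of_degree_pos S _ hdeg]
      rintro ⟨z, hz, hz0⟩
      exact Set.disjoint_left.mp hMS (Matrix.mem_spectrum_iff_isRoot_charpoly.mpr hz0) hz
    have hX := mul_aeval_of_intertwines h M.charpoly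
    rw [Matrix.aeval_self_charpoly, Matrix.zero_mul] at hX
    obtain ⟨u, hu⟩ := hunit
    calc X = X * ((u : Matrix κ κ ℂ) * ((u⁻¹ : (Matrix κ κ ℂ)ˣ) : Matrix κ κ ℂ)) := by
          rw [Units.mul_inv, Matrix.mul_one]
      _ = 0 := by rw [← Matrix.mul_assoc, hu, hX, Matrix.zero_mul]

theorem eq_zero_of_intertwines_of_disjoint_complex_spectrum {ι κ : Type*} [Fintype ι]
    [DecidableEq ι] [Fintype κ] [DecidableEq κ] {M : Matrix ι ι ℝ} {S : Matrix κ κ ℝ}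
    {X : Matrix ι κ ℝ}
    (hMS : Disjoint (spectrum ℂ (complexify M)) (spectrum ℂ (complexify S)))
    (h : X * S = M * X) : X = 0 := by
  have hc : X.map (algebraMap ℝ ℂ) * complexify S = complexify M * X.map (algebraMap ℝ ℂ) := by
    rw [complexify, complexify, ← Matrix.map_mul, ← Matrix.map_mul, h]
  have h0 := eq_zero_of_intertwines_of_disjoint_spectrum hMS hc
  ext i j
  simpa using congrFun (congrFun h0 i) j

theorem harmonicBlocks_transpose (k₀ N : ℕ) (k : Fin N → ℕ) (w : Fin N → ℝ) :
    (harmonicBlocks k₀ N k w)ᵀ = -harmonicBlocks k₀ N k w := by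
  have hJ : (!![(0 : ℝ), 1; -1, 0])ᵀ = -!![(0 : ℝ), 1; -1, 0] := by
    ext i j
    fin_cases i <;> fin_cases j <;> simp
  rw [harmonicBlocks, Matrix.fromBlocks_transpose, Matrix.fromBlocks_neg,
    Matrix.blockDiagonal'_transpose, ← Matrix.blockDiagonal'_neg]
  congr 1
  · simp
  · simp
  · simp
  · congr 1
    funext j
    rw [Matrix.transpose_smul, ← Matrix.kroneckerMap_transpose, hJ, Matrix.transpose_one,
      Pi.neg_apply, ← smul_neg]
    congr 1
    ext a b
    rw [Matrix.neg_apply, Matrix.kroneckerMap_apply, Matrix.kroneckerMap_apply,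
      Matrix.neg_apply, mul_neg]

/-- Reordering coordinates acts alike on rows and columns, so it commutes with transposition. -/
theorem IsHarmonicNormalForm.transpose_eq_neg {q : ℕ} {S : Matrix (Fin q) (Fin q) ℝ}
    (hS : IsHarmonicNormalForm S) : Sᵀ = -S := by
  obtain ⟨k₀, N, k, w, e, -, -, -, rfl⟩ := hS
  rw [Matrix.transpose_reindex, harmonicBlocks_transpose]
  rfl

theorem IsHurwitz.disjoint_spectrum {ι κ : Type*} [Fintype ι] [DecidableEq ι] [Fintype κ]
    [DecidableEq κ] {M : Matrix ι ι ℝ} {S : Matrix κ κ ℝ} (hM : IsHurwitz M)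
    (hS : ∀ z ∈ spectrum ℂ (complexify S), z.re = 0) :
    Disjoint (spectrum ℂ (complexify M)) (spectrum ℂ (complexify S)) :=
  Set.disjoint_left.mpr fun z hz hz' => (hM z hz).ne (hS z hz')

theorem IsHurwitz.transpose {ι : Type*} [Fintype ι] [DecidableEq ι] {M : Matrix ι ι ℝ}
    (hM : IsHurwitz M) : IsHurwitz Mᵀ := by
  intro z hz
  refine hM z ?_
  rw [Matrix.mem_spectrum_iff_isRoot_charpoly] at hz ⊢
  have h : complexify Mᵀ = (complexify M)ᵀ := rfl
  rwa [h, Matrix.charpoly_transpose] at hz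

section

variable {n m p q : ℕ} {A : Matrix (Fin n) (Fin n) ℝ} {B : Matrix (Fin n) (Fin m) ℝ}
  {C : Matrix (Fin p) (Fin n) ℝ} {S : Matrix (Fin q) (Fin q) ℝ} {D : Matrix (Fin p) (Fin q) ℝ}
  {Q : Matrix (Fin p) (Fin p) ℝ} {R : Matrix (Fin m) (Fin m) ℝ}

/-- Since `C * P = 0`, output injection is invisible to `P`: `A` may be replaced by the Hurwitz
matrix `A - L * C`. -/
theorem IsDetectable.eq_zero_of_intertwines (hdet : IsDetectable A C)
    (hS : ∀ z ∈ spectrum ℂ (complexify S), z.re = 0) {P : Matrix (Fin n) (Fin q) ℝ}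
    (h : P * S = A * P) (hC : C * P = 0) : P = 0 := by
  obtain ⟨L, hL⟩ := hdet
  refine eq_zero_of_intertwines_of_disjoint_complex_spectrum (hL.disjoint_spectrum hS) ?_
  rw [h, Matrix.sub_mul, Matrix.mul_assoc, hC, Matrix.mul_zero, sub_zero]

theorem IsStabilizable.isDetectable_transpose (h : IsStabilizable A B) : IsDetectable Aᵀ Bᵀ := by
  obtain ⟨K, hK⟩ := h
  refine ⟨Kᵀ, ?_⟩
  rw [← Matrix.transpose_mul, ← Matrix.transpose_sub]
  exact hK.transpose

/-- The dual of the detectable case: skewness absorbs the minus sign, so `Λ` intertwines `Sᵀ` with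
`Aᵀ`. -/
theorem IsStabilizable.eq_zero_of_intertwines (hstab : IsStabilizable A B)
    (hS : ∀ z ∈ spectrum ℂ (complexify S), z.re = 0) (hskew : Sᵀ = -S)
    {Λ : Matrix (Fin n) (Fin q) ℝ} (h : Λ * S = -(Aᵀ * Λ)) (hB : Bᵀ * Λ = 0) : Λ = 0 := by
  refine hstab.isDetectable_transpose.eq_zero_of_intertwines (S := Sᵀ) (fun z hz => ?_) ?_ hB
  · apply hS
    rw [Matrix.mem_spectrum_iff_isRoot_charpoly] at hz ⊢
    have h : complexify Sᵀ = (complexify S)ᵀ := rfl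
    rwa [h, Matrix.charpoly_transpose] at hz
  · rw [hskew, Matrix.mul_neg, h, neg_neg]

/-! ### The Hamiltonian Sylvester operator -/

theorem solvesHamiltonianSylvester_iff {P Λ : Matrix (Fin n) (Fin q) ℝ} :
    SolvesHamiltonianSylvester A B C Q R S D P Λ ↔
      P * S = A * P - B * R⁻¹ * Bᵀ * Λ ∧
        Λ * S = -(Cᵀ * Q * C * P) - Aᵀ * Λ + Cᵀ * Q * D := by
  have hadd : ∀ X₁ X₂ Y₁ Y₂ : Matrix (Fin n) (Fin q) ℝ,
      Matrix.fromRows X₁ X₂ + Matrix.fromRows Y₁ Y₂ = Matrix.fromRows (X₁ + Y₁) (X₂ + Y₂) := by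
    intro X₁ X₂ Y₁ Y₂
    ext (i | i) j <;> rfl
  rw [SolvesHamiltonianSylvester, Matrix.fromRows_mul, Matrix.fromBlocks_mul_fromRows, hadd,
    Matrix.fromRows_ext_iff]
  simp [sub_eq_add_neg]

/-- The difference of the two sides of the homogeneous Hamiltonian Sylvester equation. -/
noncomputable def hamiltonianSylvesterMap (A : Matrix (Fin n) (Fin n) ℝ)
    (B : Matrix (Fin n) (Fin m) ℝ) (C : Matrix (Fin p) (Fin n) ℝ)
    (Q : Matrix (Fin p) (Fin p) ℝ) (R : Matrix (Fin m) (Fin m) ℝ)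
    (S : Matrix (Fin q) (Fin q) ℝ) :
    Matrix (Fin n) (Fin q) ℝ × Matrix (Fin n) (Fin q) ℝ →ₗ[ℝ]
      Matrix (Fin n) (Fin q) ℝ × Matrix (Fin n) (Fin q) ℝ where
  toFun X := (X.1 * S - A * X.1 + B * R⁻¹ * Bᵀ * X.2,
    X.2 * S + Cᵀ * Q * C * X.1 + Aᵀ * X.2)
  map_add' X Y := by
    simp only [Prod.fst_add, Prod.snd_add, Matrix.add_mul, Matrix.mul_add, Prod.mk_add_mk]
    congr 1 <;> abel
  map_smul' c X := by
    simp [smul_add, smul_sub]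

theorem solvesHamiltonianSylvester_iff_map_eq {P Λ : Matrix (Fin n) (Fin q) ℝ} :
    SolvesHamiltonianSylvester A B C Q R S D P Λ ↔
      hamiltonianSylvesterMap A B C Q R S (P, Λ) = (0, Cᵀ * Q * D) := by
  rw [solvesHamiltonianSylvester_iff]
  simp only [hamiltonianSylvesterMap, LinearMap.coe_mk, AddHom.coe_mk, Prod.mk.injEq]
  refine and_congr ?_ ?_
  · rw [← sub_eq_zero]
    abel_nf
  · rw [← sub_eq_zero, ← sub_eq_zero (b := Cᵀ * Q * D)]
    abel_nf

theorem hamiltonianSylvesterMap_injective (hQ : Q.PosDef) (hR : R.PosDef)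
    (hstab : IsStabilizable A B) (hdet : IsDetectable A C)
    (hS : ∀ z ∈ spectrum ℂ (complexify S), z.re = 0) (hskew : Sᵀ = -S) :
    Function.Injective (hamiltonianSylvesterMap A B C Q R S) := by
  rw [injective_iff_map_eq_zero]
  rintro ⟨P, Λ⟩ h
  have h' : SolvesHamiltonianSylvester A B C Q R S (0 : Matrix (Fin p) (Fin q) ℝ) P Λ := by
    rw [solvesHamiltonianSylvester_iff_map_eq, h, Matrix.mul_zero]
    rfl
  obtain ⟨h₁, h₂⟩ := solvesHamiltonianSylvester_iff.mp h'
  rw [Matrix.mul_zero, add_zero] at h₂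
  -- Substituting the two equations here cancels the `A` terms and leaves two nonnegative traces
  -- summing to zero.
  have hskewtr : (Λᵀ * (P * S)).trace = -(Pᵀ * (Λ * S)).trace := by
    rw [← Matrix.trace_transpose, Matrix.transpose_mul, Matrix.transpose_mul, hskew,
      Matrix.transpose_transpose, Matrix.neg_mul, Matrix.neg_mul, Matrix.trace_neg,
      Matrix.mul_assoc, Matrix.trace_mul_comm, Matrix.mul_assoc]
  have hA : (Λᵀ * (A * P)).trace = (Pᵀ * (Aᵀ * Λ)).trace := by
    rw [← Matrix.trace_transpose]
    simp [Matrix.transpose_mul, Matrix.mul_assoc]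
  have hBtr : (Λᵀ * (B * R⁻¹ * Bᵀ * Λ)).trace = ((Bᵀ * Λ)ᵀ * R⁻¹ * (Bᵀ * Λ)).trace := by
    simp [Matrix.transpose_mul, Matrix.mul_assoc]
  have hCtr : (Pᵀ * (Cᵀ * Q * C * P)).trace = ((C * P)ᵀ * Q * (C * P)).trace := by
    simp [Matrix.transpose_mul, Matrix.mul_assoc]
  rw [h₁, h₂, Matrix.mul_sub, Matrix.mul_sub, Matrix.mul_neg, Matrix.trace_sub,
    Matrix.trace_sub, Matrix.trace_neg, hA, hBtr, hCtr] at hskewtr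
  have hB0 := trace_transpose_mul_mul_nonneg hR.inv (Bᵀ * Λ)
  have hC0 := trace_transpose_mul_mul_nonneg hQ (C * P)
  have hB : Bᵀ * Λ = 0 := eq_zero_of_trace_transpose_mul_mul_eq_zero hR.inv (by linarith)
  have hC : C * P = 0 := eq_zero_of_trace_transpose_mul_mul_eq_zero hQ (by linarith)
  have hP : P = 0 := by
    refine hdet.eq_zero_of_intertwines hS ?_ hC
    rw [h₁, Matrix.mul_assoc (B * R⁻¹), hB, Matrix.mul_zero, sub_zero]
  have hΛ : Λ = 0 := by
    refine hstab.eq_zero_of_intertwines hS hskew ?_ hB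
    rw [h₂, hP, Matrix.mul_zero, neg_zero, zero_sub]
  rw [hP, hΛ]
  rfl

/-! ### Optimality -/

/-- Along feasible directions the objective is its value at a point given by the Hamiltonian
equation plus the quadratic form of the direction. -/
theorem traceCost_eq_add_of_solves (hQ : Q.PosDef) (hR : R.PosDef) (hskew : Sᵀ = -S)
    {P Λ : Matrix (Fin n) (Fin q) ℝ}
    (hsol : SolvesHamiltonianSylvester A B C Q R S D P Λ)
    {X : Matrix (Fin n) (Fin q) ℝ} {U : Matrix (Fin m) (Fin q) ℝ}
    (hX : X * S = A * X + B * U) :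
    traceCost C Q R D (P + X, -(R⁻¹ * Bᵀ * Λ) + U) =
      traceCost C Q R D (P, -(R⁻¹ * Bᵀ * Λ)) +
        (((C * X)ᵀ * Q * (C * X)).trace + (Uᵀ * R * U).trace) := by
  have hQt : Qᵀ = Q := by simpa using hQ.isHermitian.eq
  have hRt : Rᵀ = R := by simpa using hR.isHermitian.eq
  obtain ⟨-, h₂⟩ := solvesHamiltonianSylvester_iff.mp hsol
  set G := -(R⁻¹ * Bᵀ * Λ) with hG
  have hRG : R * G = -(Bᵀ * Λ) := by
    rw [hG, Matrix.mul_neg, Matrix.mul_assoc, ← Matrix.mul_assoc R,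
      Matrix.mul_nonsing_inv _ ((Matrix.isUnit_iff_isUnit_det _).mp hR.isUnit), Matrix.one_mul]
  have hE : Cᵀ * (Q * (C * P - D)) = -(Λ * S) - Aᵀ * Λ := by
    rw [h₂]
    simp only [Matrix.mul_sub, Matrix.mul_assoc]
    abel
  -- Half the first variation of the cost. The adjoint equation and the transposed constraint
  -- express both terms through `Λ`, and cyclicity of the trace cancels them.
  have hcross : (Xᵀ * (Cᵀ * (Q * (C * P - D)))).trace + (Uᵀ * (R * G)).trace = 0 := by
    have hBU : Uᵀ * Bᵀ = -(S * Xᵀ) - Xᵀ * Aᵀ := by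
      have h := congrArg Matrix.transpose hX
      rw [Matrix.transpose_add, Matrix.transpose_mul, Matrix.transpose_mul,
        Matrix.transpose_mul, hskew, Matrix.neg_mul] at h
      rw [h]
      abel
    rw [hE, hRG, Matrix.mul_neg, ← Matrix.mul_assoc Uᵀ, hBU, Matrix.sub_mul, Matrix.mul_sub,
      Matrix.neg_mul, Matrix.mul_neg, Matrix.trace_neg, Matrix.trace_sub, Matrix.trace_sub,
      Matrix.trace_neg, Matrix.trace_neg, Matrix.mul_assoc S, Matrix.trace_mul_comm S,
      Matrix.mul_assoc, Matrix.mul_assoc]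
    ring
  have hsymmQ : ((C * P - D)ᵀ * (Q * (C * X))).trace =
      (Xᵀ * (Cᵀ * (Q * (C * P - D)))).trace := by
    rw [← Matrix.trace_transpose]
    simp only [Matrix.transpose_mul, Matrix.transpose_transpose, hQt, Matrix.mul_assoc]
  have hsymmR : (Gᵀ * (R * U)).trace = (Uᵀ * (R * G)).trace := by
    rw [← Matrix.trace_transpose]
    simp only [Matrix.transpose_mul, Matrix.transpose_transpose, hRt, Matrix.mul_assoc]
  have hexp : C * (P + X) - D = (C * P - D) + C * X := by
    rw [Matrix.mul_add]
    abel
  have hXC : (C * X)ᵀ * (Q * (C * P - D)) = Xᵀ * (Cᵀ * (Q * (C * P - D))) := by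
    rw [Matrix.transpose_mul, Matrix.mul_assoc]
  simp only [traceCost]
  rw [hexp]
  generalize C * P - D = E at *
  generalize C * X = Y at *
  simp only [Matrix.transpose_add, Matrix.add_mul, Matrix.mul_add, Matrix.trace_add,
    Matrix.mul_assoc]
  rw [hXC, hsymmQ, hsymmR]
  linarith

end

theorem mainTheorem2 {n m p q : ℕ}
    (A : Matrix (Fin n) (Fin n) ℝ) (B : Matrix (Fin n) (Fin m) ℝ)
    (C : Matrix (Fin p) (Fin n) ℝ)
    (Abar : Matrix (Fin q) (Fin q) ℝ) (Cbar : Matrix (Fin p) (Fin q) ℝ)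
    (Q : Matrix (Fin p) (Fin p) ℝ) (R : Matrix (Fin m) (Fin m) ℝ)
    (hQ : Q.PosDef) (hR : R.PosDef)
    (hstab : IsStabilizable A B) (hdet : IsDetectable A C)
    (hspec : HasSemisimpleImaginarySpectrum Abar)
    (hfreq : HasRationalFrequencyRatios Abar)
    (hform : IsHarmonicNormalForm Abar) :
    ∃ (P Λ : Matrix (Fin n) (Fin q) ℝ) (G : Matrix (Fin m) (Fin q) ℝ),
      (∀ P' Λ' : Matrix (Fin n) (Fin q) ℝ,
        SolvesHamiltonianSylvester A B C Q R Abar Cbar P' Λ' ↔ P' = P ∧ Λ' = Λ) ∧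
      G = -(R⁻¹ * Bᵀ * Λ) ∧
      traceArgmin A B C Q R Abar Cbar = {(P, G)} := by
  have hS : ∀ z ∈ spectrum ℂ (complexify Abar), z.re = 0 := fun z hz => (hspec z hz).1
  have hskew := hform.transpose_eq_neg
  have hinj := hamiltonianSylvesterMap_injective hQ hR hstab hdet hS hskew
  obtain ⟨⟨P, Λ⟩, hPΛ⟩ := LinearMap.injective_iff_surjective.mp hinj (0, Cᵀ * Q * Cbar)
  have hsol := solvesHamiltonianSylvester_iff_map_eq.mpr hPΛ
  have hfeas : P * Abar = A * P + B * -(R⁻¹ * Bᵀ * Λ) := by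
    rw [(solvesHamiltonianSylvester_iff.mp hsol).1, Matrix.mul_neg, ← sub_eq_add_neg,
      Matrix.mul_assoc, Matrix.mul_assoc, Matrix.mul_assoc]
  have hcost : ∀ Y ∈ regulatorFeasible A B Abar,
      (Y.1 - P) * Abar = A * (Y.1 - P) + B * (Y.2 - -(R⁻¹ * Bᵀ * Λ)) ∧
      traceCost C Q R Cbar Y = traceCost C Q R Cbar (P, -(R⁻¹ * Bᵀ * Λ)) +
        (((C * (Y.1 - P))ᵀ * Q * (C * (Y.1 - P))).trace +
          ((Y.2 - -(R⁻¹ * Bᵀ * Λ))ᵀ * R * (Y.2 - -(R⁻¹ * Bᵀ * Λ))).trace) := by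
    intro Y hY
    have hY' : Y.1 * Abar = A * Y.1 + B * Y.2 := hY
    have hdir : (Y.1 - P) * Abar = A * (Y.1 - P) + B * (Y.2 - -(R⁻¹ * Bᵀ * Λ)) := by
      rw [Matrix.sub_mul, hY', hfeas, Matrix.mul_sub A, Matrix.mul_sub B]
      abel
    refine ⟨hdir, ?_⟩
    rw [← traceCost_eq_add_of_solves hQ hR hskew hsol hdir, add_sub_cancel, add_sub_cancel]
  refine ⟨P, Λ, _, fun P' Λ' => ?_, rfl, Set.Subset.antisymm ?_ ?_⟩
  · rw [solvesHamiltonianSylvester_iff_map_eq, ← hPΛ, hinj.eq_iff, Prod.mk.injEq]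
  · rintro Y ⟨hY, hmin⟩
    obtain ⟨hdir, hval⟩ := hcost Y hY
    -- Comparison with the stationary point bounds the quadratic excess of `Y` by zero, so both of
    -- its parts vanish.
    have hle := hmin (P, -(R⁻¹ * Bᵀ * Λ)) hfeas
    have hQ0 := trace_transpose_mul_mul_nonneg hQ (C * (Y.1 - P))
    have hR0 := trace_transpose_mul_mul_nonneg hR (Y.2 - -(R⁻¹ * Bᵀ * Λ))
    have hU : Y.2 - -(R⁻¹ * Bᵀ * Λ) = 0 :=
      eq_zero_of_trace_transpose_mul_mul_eq_zero hR (by linarith)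
    have hC : C * (Y.1 - P) = 0 := eq_zero_of_trace_transpose_mul_mul_eq_zero hQ (by linarith)
    rw [hU, Matrix.mul_zero, add_zero] at hdir
    have hX := hdet.eq_zero_of_intertwines hS hdir hC
    exact Prod.ext (sub_eq_zero.mp hX) (sub_eq_zero.mp hU)
  · rintro _ rfl
    refine ⟨hfeas, fun Y hY => ?_⟩
    rw [(hcost Y hY).2]
    have hQ0 := trace_transpose_mul_mul_nonneg hQ (C * (Y.1 - P))
    have hR0 := trace_transpose_mul_mul_nonneg hR (Y.2 - -(R⁻¹ * Bᵀ * Λ))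
    linarith
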